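/- Let $U\subset\mathbb C$ be a domain conformally equivalent to the unit disk $\mathbb D$, let $U'=U_1\cup\dots\cup U_N$ with pairwise disjoint $U_i\simeq\mathbb D$ (conformally) and $\overline{U'}$ a compact subset of $U$, and let $f:U'\to U$ be a proper holomorphic map of degree $d>1$, where $d$ is the sum of the degrees of the restrictions $f:U_i\to U$. Put $K_f=\{z\in U' : f^n(z)\in U' \text{ for all } n\ge 0\}$ and $J_f=\partial K_f$, and assume that $K_f=J_f$ is a Cantor set containing all critical points of $f$. Write $\deg(f,z)$ for the local degree of $f$ at $z$. Let $\Sigma_d=\{0,\dots,d-1\}^{\mathbb N}$ be the space of sequences $\epsilon=(\epsilon_1,\epsilon_2,\dots)$, let $\sigma$ be the shift on $\Sigma_d$, and write $\epsilon^k=(\epsilon_1,\dots,\epsilon_k)$; the notation $\sigma(\epsilon_1,\dots,\epsilon_k)=(\epsilon_2,\dots,\epsilon_k)$ is also used for blocks. Let $\phi:\mathbb D\to U\setminus J_f$ be a holomorphic universal covering with deck transformation group $\Gamma$, and let $g_0,\dots,g_{d-1}:\mathbb D\to\mathbb D$ be holomorphic maps with $\phi\circ g_j(\mathbb D)\subset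 U'$ and $f\circ\phi\circ g_j=\phi$ such that the points $\phi(g_0(0)),\dots,\phi(g_{d-1}(0))$ are distinct (they are then the $d$ preimages of $\phi(0)$ under $f$). For every $k\ge1$ and every block $\epsilon^k\in\{0,\dots,d-1\}^k$ let $\gamma_1^{\epsilon^k},\dots,\gamma_k^{\epsilon^k}\in\Gamma$ be given, and put $$V_{\epsilon^k}=\gamma_1^{\epsilon^k}\circ g_{\epsilon_1}\circ\dots\circ\gamma_k^{\epsilon^k}\circ g_{\epsilon_k}(\mathbb D).$$ Suppose the family is chosen such that 1. $V_{\epsilon^k}\subset V_{\epsilon^{k-1}}$ for all $k\ge2$ and all $\epsilon^k$, where $\epsilon^{k-1}=(\epsilon_1,\dots,\epsilon_{k-1})$; 2. $\gamma_l^{\epsilon^k}=\gamma_{l-1}^{\sigma(\epsilon^k)}$ for all $k\ge 2$, all $\epsilon^k$ and all $2\le l\le k$; 3. for all $k\ge1$ and all $\epsilon^k,\widehat\epsilon^k$: if $\phi(V_{\epsilon^k})=\phi(V_{\widehat\epsilon^k})$, then $V_{\epsilon^k}=V_{\widehat\epsilon^k}$. Then for every $\epsilon\in\Sigma_d$ the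 set $\bigcap_{k\ge1}\overline{\phi(V_{\epsilon^k})}$ consists of a single point $\pi(\epsilon)$, which lies in $J_f$, and the map $\pi:\Sigma_d\to J_f$ so defined has the following property. For every $z\in J_f$, $$\#\pi^{-1}(z)=\deg(f,z)\cdot\#\pi^{-1}(f(z)).$$ More precisely, for every $z\in J_f$ there are $d_z=\deg(f,z)$ distinct symbols $j_1,\dots,j_{d_z}\in\{0,\dots,d-1\}$, depending only on $z$, such that for every $\epsilon\in\Sigma_d$: $\pi(\epsilon)=z$ if and only if $\pi(\sigma(\epsilon))=f(z)$ and $\epsilon_1\in\{j_1,\dots,j_{d_z}\}$. -/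

import Mathlib

namespace PolyLikeShift

open Set Metric Complex.UnitDisc

noncomputable section

/-- A complex valued function on the open unit disk is holomorphic. -/
def HolomorphicOnDisk (F : 𝔻 → ℂ) : Prop :=
  ∃ G : ℂ → ℂ, DifferentiableOn ℂ G (ball 0 1) ∧ ∀ z : 𝔻, G z = F z

/-- `V ⊆ ℂ` is conformally equivalent to the unit disk. -/
def IsConformalDisk (V : Set ℂ) : Prop :=
  ∃ h : 𝔻 → ℂ, HolomorphicOnDisk h ∧ Function.Injective h ∧ range h = V

/-- The local degree `deg(f, z)`: the order of vanishing of `f - f z` at `z`. -/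
def localDegree (f : ℂ → ℂ) (z : ℂ) : ℕ :=
  analyticOrderNatAt (fun x => f x - f z) z

/-- `f : V → U` has degree `n`: every point of `U` has exactly `n` preimages in `V`, counted with
multiplicity. -/
def HasDegree (f : ℂ → ℂ) (V U : Set ℂ) (n : ℕ) : Prop :=
  ∀ w ∈ U, ∑ᶠ z ∈ V ∩ f ⁻¹' {w}, localDegree f z = n

/-- `f : U' → U` is a generalized polynomial-like map, where `U'` is the disjoint union of the
disks `D i`. Only the values of `f` on `U'` matter. -/
structure IsGenPolynomialLike (f : ℂ → ℂ) (U' U : Set ℂ) {N : ℕ} (D : Fin N → Set ℂ) : Prop where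
  disk : IsConformalDisk U
  disk_component : ∀ i, IsConformalDisk (D i)
  disjoint : Pairwise fun i j => Disjoint (D i) (D j)
  union : U' = ⋃ i, D i
  compact : IsCompact (closure U')
  closure_subset : closure U' ⊆ U
  holomorphic : DifferentiableOn ℂ f U'
  proper : ∃ h : MapsTo f U' U, IsProperMap (h.restrict f U' U)

/-- The degree of a generalized polynomial-like map: the sum of the degrees of its restrictions to
the disks `D i`. -/
def HasTotalDegree (f : ℂ → ℂ) (U : Set ℂ) {N : ℕ} (D : Fin N → Set ℂ) (d : ℕ) : Prop :=
  ∃ e : Fin N → ℕ, (∀ i, HasDegree f (D i) U (e i)) ∧ d = ∑ i, e i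

/-- The filled-in Julia set `K_f` of `f : U' → U`. -/
def filledJulia (f : ℂ → ℂ) (U' : Set ℂ) : Set ℂ :=
  {z | z ∈ U' ∧ ∀ n : ℕ, f^[n] z ∈ U'}

/-- The Julia set `J_f = ∂K_f`. -/
def julia (f : ℂ → ℂ) (U' : Set ℂ) : Set ℂ :=
  frontier (filledJulia f U')

/-- `K` is a Cantor set: it is homeomorphic to `{0,1}^ℕ`. -/
def IsCantorSet (K : Set ℂ) : Prop :=
  Nonempty (K ≃ₜ (ℕ → Bool))

/-- `φ : 𝔻 → X` is a holomorphic universal covering of `X ⊆ ℂ`, i.e. a surjective holomorphic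
covering map (the disk being simply connected). -/
structure IsUniversalCovering (φ : 𝔻 → ℂ) (X : Set ℂ) : Prop where
  holomorphic : HolomorphicOnDisk φ
  range_eq : range φ = X
  covering : ∃ h : ∀ z, φ z ∈ X, IsCoveringMap (codRestrict φ X h)

/-- The set of deck transformations of `φ`: the automorphisms `γ` of the unit disk with
`φ ∘ γ = φ`. -/
def deckTransformations (φ : 𝔻 → ℂ) : Set (𝔻 ≃ₜ 𝔻) :=
  {γ | HolomorphicOnDisk (fun z => (γ z : ℂ)) ∧ ∀ z, φ (γ z) = φ z}

/-- `g j`, `j = 0, …, d - 1`, are lifts of the inverse of `f : U' → U` to the universal covering: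
holomorphic self-maps of the disk such that `φ ∘ g j` maps into `U'` and `f ∘ φ ∘ g j = φ`, the
points `φ (g j 0)` being distinct (so that they are the `d` preimages of the base point `φ 0`). -/
structure AreLiftedInverses (f : ℂ → ℂ) (U' : Set ℂ) (φ : 𝔻 → ℂ) {d : ℕ} (g : Fin d → 𝔻 → 𝔻) :
    Prop where
  holomorphic : ∀ j, HolomorphicOnDisk (fun z => (g j z : ℂ))
  mem : ∀ j z, φ (g j z) ∈ U'
  lift : ∀ j z, f (φ (g j z)) = φ z
  injective : Function.Injective fun j => φ (g j 0)

/-- The composition `γ₁ ∘ g_{ε₁} ∘ ⋯ ∘ γ_k ∘ g_{ε_k}` (the identity for `k = 0`). -/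
def composition {d : ℕ} (g : Fin d → 𝔻 → 𝔻) :
    (k : ℕ) → (Fin k → (𝔻 ≃ₜ 𝔻)) → (Fin k → Fin d) → 𝔻 → 𝔻
  | 0, _, _ => id
  | k + 1, γ, e => γ 0 ∘ g (e 0) ∘ composition g k (Fin.tail γ) (Fin.tail e)

/-- For a family `γ k e l = γ_l^e`, `e` a `k`-block, `1 ≤ l ≤ k` (indices are shifted by one), the
set `V_e = γ₁^e ∘ g_{e₁} ∘ ⋯ ∘ γ_k^e ∘ g_{e_k} (𝔻)`. -/
def liftedSet {d : ℕ} (g : Fin d → 𝔻 → 𝔻)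
    (γ : (k : ℕ) → (Fin k → Fin d) → Fin k → (𝔻 ≃ₜ 𝔻)) (k : ℕ) (e : Fin k → Fin d) : Set 𝔻 :=
  range (composition g k (γ k e) e)

/-- A family of deck transformations that is nested, shift invariant and merged.
The cases of empty blocks hold trivially. -/
structure IsGoodFamily (φ : 𝔻 → ℂ) {d : ℕ} (g : Fin d → 𝔻 → 𝔻)
    (γ : (k : ℕ) → (Fin k → Fin d) → Fin k → (𝔻 ≃ₜ 𝔻)) : Prop where
  deck : ∀ k e l, γ k e l ∈ deckTransformations φ
  nested : ∀ k (e : Fin (k + 1) → Fin d), liftedSet g γ (k + 1) e ⊆ liftedSet g γ k (Fin.init e)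
  shift_invariant : ∀ k (e : Fin (k + 1) → Fin d) (l : Fin k),
    γ (k + 1) e l.succ = γ k (Fin.tail e) l
  merged : ∀ k (e e' : Fin k → Fin d),
    φ '' liftedSet g γ k e = φ '' liftedSet g γ k e' → liftedSet g γ k e = liftedSet g γ k e'

/-- The one-sided shift. A sequence is indexed from `0`: its first symbol is `ε 0`. -/
def shift {d : ℕ} (ε : ℕ → Fin d) : ℕ → Fin d := fun n => ε (n + 1)

/-- The set `⋂_{k ≥ 1} closure (φ (V_{ε^k}))`, where `ε^k` is the block of the first `k` symbols
of `ε`. -/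
def limitSet (φ : 𝔻 → ℂ) {d : ℕ} (g : Fin d → 𝔻 → 𝔻)
    (γ : (k : ℕ) → (Fin k → Fin d) → Fin k → (𝔻 ≃ₜ 𝔻)) (ε : ℕ → Fin d) : Set ℂ :=
  ⋂ k : ℕ, closure (φ '' liftedSet g γ (k + 1) fun i => ε i)

end

end PolyLikeShift

namespace PolyLikeShift

open Set Metric Complex.UnitDisc Topology Filter

/-! Write K for the Cantor set `K_f = J_f`. All critical points lie in K, so `f^k` is a local
homeomorphism on `f⁻ᵏ(U) \ K`, and each `φ(V_e)` with e a k-block is a connected component of that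
set. Along a sequence the closures of these components shrink to a continuum inside K, hence to a
point.

A Cantor set does not separate a disk. If `π ε = π ε'`, a punctured neighbourhood (a small disk
minus K) of the common point therefore lies in one component, and `φ(V_{ε^k}) = φ(V_{ε'^k})` for all
k. Merging lifts this to equality of the sets V, so applying `g_j` shows that `π(jε)` depends only
on j and `π ε`.

It remains to count the symbols j with `π(jε) = z`, where `π ε = f z`. For q in `V_{ε^k}` with k
large, the points `φ(g_j q)` for these j are distinct preimages of `φ q` near z, so there are at
most `deg(f,z)` of them. Summed over the fibre of `π ε`, both the symbol counts and the local
degrees give d, so equality holds at every point. -/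

/-! ### Totally disconnected sets do not separate a disk -/

theorem isPreconnected_inter_of_union_eq_univ {X : Type*} [TopologicalSpace X]
    [SimplyConnectedSpace X] [LocallyPathConnectedSpace X] [NormalSpace X] {F F' : Set X}
    (hF : IsClosed F) (hF' : IsClosed F') (cF : IsPreconnected F) (cF' : IsPreconnected F')
    (hu : F ∪ F' = univ) : IsPreconnected (F ∩ F') := by
  rw [isPreconnected_closed_iff]
  intro t t' ht ht' hs ⟨p, hp, hpt⟩ ⟨q, hq, hqt⟩
  by_contra hne
  have hdis : Disjoint (F ∩ F' ∩ t) (F ∩ F' ∩ t') := by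
    rw [Set.disjoint_left]
    rintro x ⟨hx, hxt⟩ ⟨_, hxt'⟩
    exact hne ⟨x, hx, hxt, hxt'⟩
  obtain ⟨u, hu0, hu1, -⟩ := exists_continuous_zero_one_of_isClosed
    ((hF.inter hF').inter ht) ((hF.inter hF').inter ht') hdis
  classical
  -- Unicoherence by lifting: u is 0 on one piece of `F ∩ F'` and 1 on the other, so the two
  -- formulas agree there. A lift of G through `Circle.exp` vanishing at p must be `π u` on F and
  -- `-π u` on F', which contradict each other at q.
  let G : X → Circle := F.piecewise (fun x => Circle.exp (Real.pi * u x))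
    (fun x => Circle.exp (-(Real.pi * u x)))
  have hpi : Circle.exp Real.pi = Circle.exp (-Real.pi) := by
    apply Circle.ext
    simp [Circle.coe_exp, Complex.exp_pi_mul_I]
  have hagree : ∀ x ∈ F ∩ F', Circle.exp (Real.pi * u x) = Circle.exp (-(Real.pi * u x)) := by
    intro x hx
    rcases hs hx with h | h
    · simp [hu0 ⟨hx, h⟩]
    · simpa [hu1 ⟨hx, h⟩] using hpi
  have hG : Continuous G := by
    refine Continuous.piecewise (fun x hx => hagree x ⟨hF.frontier_subset hx, ?_⟩)
      (by fun_prop) (by fun_prop)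
    have h1 : x ∈ closure Fᶜ := by
      rw [frontier_eq_closure_inter_closure] at hx; exact hx.2
    refine hF'.closure_subset_iff.2 ?_ h1
    intro y hy
    have : y ∈ F ∪ F' := hu ▸ mem_univ y
    exact this.resolve_left hy
  have hGF : EqOn G (fun x => Circle.exp (Real.pi * u x)) F := F.piecewise_eqOn _ _
  have hGF' : EqOn G (fun x => Circle.exp (-(Real.pi * u x))) F' := by
    intro x hx
    by_cases h : x ∈ F
    · rw [hGF h]; exact hagree x ⟨h, hx⟩
    · exact F.piecewise_eqOn_compl _ _ h
  have hGp : G p = 1 := by rw [hGF hp.1]; simp [hu0 ⟨hp, hpt⟩]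
  obtain ⟨L, ⟨hLp, hL⟩, -⟩ := Circle.isCoveringMap_exp.existsUnique_continuousMap_lifts
    ⟨G, hG⟩ p 0 (by simp [hGp])
  have hL' : ∀ x, Circle.exp (L x) = G x := fun x => congr_fun hL x
  have e1 : EqOn L (fun x => Real.pi * u x) F :=
    Circle.isCoveringMap_exp.eqOn_of_comp_eqOn cF (by fun_prop) (by fun_prop)
      (fun x hx => by simp only [Function.comp, hL', hGF hx]) hp.1
      (by simp [hLp, hu0 ⟨hp, hpt⟩])
  have e2 : EqOn L (fun x => -(Real.pi * u x)) F' :=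
    Circle.isCoveringMap_exp.eqOn_of_comp_eqOn cF' (by fun_prop) (by fun_prop)
      (fun x hx => by simp only [Function.comp, hL', hGF' hx]) hp.2
      (by simp [hLp, hu0 ⟨hp, hpt⟩])
  have := (e1 hq.1).symm.trans (e2 hq.2)
  simp only [hu1 ⟨hq, hqt⟩, Pi.one_apply, mul_one] at this
  linarith [Real.pi_pos]

/-- The closure of every other component of `Sᶜ` is connected and touches S; otherwise that
component would be clopen. Hence S glues these closures together. -/
theorem isPreconnected_compl_connectedComponentIn_compl {X : Type*} [TopologicalSpace X]
    [PreconnectedSpace X] [LocallyConnectedSpace X] {S : Set X} (hS : IsClosed S)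
    (cS : IsConnected S) (x : X) : IsPreconnected (connectedComponentIn Sᶜ x)ᶜ := by
  obtain ⟨s, hs⟩ := cS.nonempty
  have hSE : S ⊆ (connectedComponentIn Sᶜ x)ᶜ := fun y hy hy' =>
    connectedComponentIn_subset _ _ hy' hy
  have oE := hS.isOpen_compl.connectedComponentIn (x := x)
  refine isPreconnected_of_forall s fun y hy => ?_
  by_cases hyS : y ∈ S
  · exact ⟨S, hSE, hs, hyS, cS.isPreconnected⟩
  set C := connectedComponentIn Sᶜ y
  have hyC : y ∈ C := mem_connectedComponentIn hyS
  have hCE : closure C ⊆ (connectedComponentIn Sᶜ x)ᶜ := by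
    refine oE.isClosed_compl.closure_subset_iff.2 fun z hz hz' => hy ?_
    rw [connectedComponentIn_eq hz', ← connectedComponentIn_eq hz]
    exact hyC
  have hpc : IsPreconnected (closure C) := isPreconnected_connectedComponentIn.closure
  have hne : (closure C ∩ S).Nonempty := by
    by_contra h
    have hsub : closure C ⊆ C := hpc.subset_connectedComponentIn (subset_closure hyC)
      fun z hz hzS => h ⟨z, hz, hzS⟩
    have hcl : IsClopen C :=
      ⟨closure_subset_iff_isClosed.1 hsub, hS.isOpen_compl.connectedComponentIn⟩
    have : C = univ := hcl.eq_univ ⟨y, hyC⟩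
    exact connectedComponentIn_subset _ _ (this ▸ mem_univ s : s ∈ C) hs
  obtain ⟨a, ha, haS⟩ := hne
  exact ⟨closure C ∪ S, union_subset hCE hSE, .inr hs, .inl (subset_closure hyC),
    hpc.union a ha haS cS.isPreconnected⟩

/-- Suppose C is a component of `Jᶜ` missing y, and let E be the component of `(closure C)ᶜ` at y.
By unicoherence the frontier of E is connected; it lies in J, so it is at most one point. As a point
does not separate X, E is too large to leave room for C. -/
theorem isPreconnected_compl_of_isTotallyDisconnected {X : Type*} [TopologicalSpace X]
    [SimplyConnectedSpace X] [LocallyPathConnectedSpace X] [T4Space X]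
    (hX : ∀ x : X, IsPreconnected ({x}ᶜ : Set X)) {J : Set X} (hJ : IsClosed J)
    (tJ : IsTotallyDisconnected J) : IsPreconnected Jᶜ := by
  rcases Jᶜ.eq_empty_or_nonempty with h | ⟨x, hx⟩
  · rw [h]; exact isPreconnected_empty
  suffices Jᶜ ⊆ connectedComponentIn Jᶜ x by
    rw [this.antisymm (connectedComponentIn_subset _ _)]
    exact isPreconnected_connectedComponentIn
  intro y hy
  by_contra hyC
  set C := connectedComponentIn Jᶜ x with hC
  have oC : IsOpen C := hJ.isOpen_compl.connectedComponentIn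
  have hxC : x ∈ C := mem_connectedComponentIn hx
  have key : ∀ p ∉ J, p ∈ closure C → p ∈ C := by
    intro p hp hpc
    obtain ⟨a, ha, haC⟩ := mem_closure_iff.1 hpc _
      (hJ.isOpen_compl.connectedComponentIn (x := p)) (mem_connectedComponentIn hp)
    rw [hC, connectedComponentIn_eq haC, ← connectedComponentIn_eq ha]
    exact mem_connectedComponentIn hp
  have hyC' : y ∈ (closure C)ᶜ := fun h => hyC (key y hy h)
  have cC : IsConnected (closure C) :=
    ⟨⟨x, subset_closure hxC⟩, isPreconnected_connectedComponentIn.closure⟩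
  set E := connectedComponentIn (closure C)ᶜ y with hE
  have oE : IsOpen E := isClosed_closure.isOpen_compl.connectedComponentIn
  have hyE : y ∈ E := mem_connectedComponentIn hyC'
  have hEC : ∀ z ∈ E, z ∉ closure C := fun z hz => connectedComponentIn_subset _ _ hz
  have hfr : IsPreconnected (closure E ∩ Eᶜ) :=
    isPreconnected_inter_of_union_eq_univ isClosed_closure oE.isClosed_compl
      isPreconnected_connectedComponentIn.closure
      (isPreconnected_compl_connectedComponentIn_compl isClosed_closure cC y)
      (by
        rw [eq_univ_iff_forall]
        intro z
        by_cases hz : z ∈ E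
        · exact .inl (subset_closure hz)
        · exact .inr hz)
  have hfrJ : closure E ∩ Eᶜ ⊆ J := by
    rintro p ⟨hp, hpE⟩
    by_contra hpJ
    by_cases hpC : p ∈ closure C
    · obtain ⟨a, haC, haE⟩ := mem_closure_iff.1 hp C oC (key p hpJ hpC)
      exact hEC a haE (subset_closure haC)
    · obtain ⟨a, ha, haE⟩ := mem_closure_iff.1 hp _
        (isClosed_closure.isOpen_compl.connectedComponentIn (x := p))
        (mem_connectedComponentIn (F := (closure C)ᶜ) hpC)
      apply hpE
      rw [hE, connectedComponentIn_eq haE, ← connectedComponentIn_eq ha]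
      exact mem_connectedComponentIn hpC
  have hsub := tJ _ hfrJ hfr
  obtain ⟨p, hpE, hp⟩ : ∃ p ∉ E, closure E ∩ Eᶜ ⊆ {p} := by
    rcases (closure E ∩ Eᶜ).eq_empty_or_nonempty with h | ⟨p, hp⟩
    -- If the frontier is empty, any point outside E will do.
    · exact ⟨x, fun h => hEC x h (subset_closure hxC), by simp [h]⟩
    · exact ⟨p, hp.2, fun q hq => hsub hq hp⟩
  have hpE' : {p}ᶜ ⊆ E := by
    refine (hX p).subset_of_closure_inter_subset oE ⟨y, fun h => hpE (h ▸ hyE), hyE⟩ ?_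
    rintro z ⟨hz, hzp⟩
    by_contra hzE
    exact hzp (hp ⟨hz, hzE⟩)
  have hCp : C ⊆ {p} := fun z hz => by
    by_contra h
    exact hEC z (hpE' h) (subset_closure hz)
  have hcl : IsClopen C :=
    ⟨(subsingleton_singleton.anti hCp).isClosed, oC⟩
  exact hyC (hcl.eq_univ ⟨x, hxC⟩ ▸ mem_univ y)

theorem isPreconnected_ball_diff_of_isTotallyDisconnected {J : Set ℂ} (hJ : IsClosed J)
    (tJ : IsTotallyDisconnected J) (c : ℂ) {r : ℝ} (hr : 0 < r) :
    IsPreconnected (ball c r \ J) := by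
  let e := OpenPartialHomeomorph.univBall (E := ℂ) c r
  have hinj : Function.Injective e := by
    have := e.injOn
    rwa [OpenPartialHomeomorph.univBall_source, injOn_univ] at this
  have hcont : Continuous e := OpenPartialHomeomorph.continuous_univBall c r
  have him : e '' univ = ball c r := by
    have := e.image_source_eq_target
    rwa [OpenPartialHomeomorph.univBall_source,
      OpenPartialHomeomorph.univBall_target c hr] at this
  have h1 : IsPreconnected (e ⁻¹' J)ᶜ := by
    refine isPreconnected_compl_of_isTotallyDisconnected
      (fun x => (isConnected_compl_singleton_of_one_lt_rank (by simp) x).isPreconnected)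
      (hJ.preimage hcont) ?_
    intro t ht hpt x hx y hy
    exact hinj (tJ (e '' t) (image_subset_iff.2 ht) (hpt.image _ hcont.continuousOn)
      (mem_image_of_mem _ hx) (mem_image_of_mem _ hy))
  have h2 := h1.image e hcont.continuousOn
  rwa [← preimage_compl, image_preimage_eq_inter_range, ← image_univ, him, inter_comm,
    ← sdiff_eq] at h2

/-! ### Lifts of coverings, local degree, nested continua -/

/-- F need not be a covering. For closedness, take y in the closure and a connected W around `F y`
small enough for a local inverse of F at y and for sections of φ. The section through some q with `ψ
q` near y, followed by ψ, agrees with the inverse at `φ q`, hence on W, and so reaches y. -/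
theorem isClopen_range_of_isCoveringMap_comp {X Y Z : Type*} [TopologicalSpace X]
    [TopologicalSpace Y] [TopologicalSpace Z] [T2Space Y] [LocallyConnectedSpace Z]
    {F : Y → Z} {φ : X → Z} {ψ : X → Y} (hF : IsLocalHomeomorph F) (hφ : IsCoveringMap φ)
    (sφ : Function.Surjective φ) (hψ : Continuous ψ) (h : F ∘ ψ = φ) : IsClopen (range ψ) := by
  refine ⟨?_, (IsLocalHomeomorph.of_comp (h ▸ hφ.isLocalHomeomorph) hF hψ).isOpenMap.isOpen_range⟩
  rw [← closure_subset_iff_isClosed]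
  intro y hy
  have : Nonempty (φ ⁻¹' {F y}) := by
    obtain ⟨x, hx⟩ := sφ (F y)
    exact ⟨⟨x, hx⟩⟩
  let e := (hφ (F y)).toTrivialization
  have he : F y ∈ e.baseSet := (hφ (F y)).mem_toTrivialization_baseSet
  obtain ⟨b, hyb, hb⟩ := hF y
  set W := connectedComponentIn (e.baseSet ∩ b.target) (F y) with hW
  have hyt : F y ∈ b.target := by rw [hb]; exact b.map_source hyb
  have oW : IsOpen W := (e.open_baseSet.inter b.open_target).connectedComponentIn
  have hyW : F y ∈ W := mem_connectedComponentIn ⟨he, hyt⟩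
  have hWs : W ⊆ e.baseSet ∩ b.target := connectedComponentIn_subset _ _
  have oN : IsOpen (b.source ∩ F ⁻¹' W) := b.open_source.inter (oW.preimage hF.continuous)
  obtain ⟨_, ⟨hqs, hqW⟩, q, rfl⟩ := mem_closure_iff.1 hy _ oN ⟨hyb, hyW⟩
  have hφq : φ q ∈ W := by rw [← h]; exact hqW
  let s : Z → X := fun w => e.toOpenPartialHomeomorph.symm (w, (e q).2)
  have hs : ContinuousOn s W := by
    refine e.toOpenPartialHomeomorph.continuousOn_symm.comp (by fun_prop) fun w hw => ?_
    exact e.mem_target.2 (hWs hw).1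
  have hsφ : ∀ w ∈ W, φ (s w) = w := fun w hw => e.proj_symm_apply' (hWs hw).1
  have hsq : s (φ q) = q := e.symm_apply_mk_proj (hWs hφq).1
  have hFψ : ∀ x, F (ψ x) = φ x := fun x => congr_fun h x
  have heq : EqOn (ψ ∘ s) b.symm W := by
    refine (T2Space.isSeparatedMap F).eqOn_of_comp_eqOn hF.isLocallyInjective
      isPreconnected_connectedComponentIn (hψ.comp_continuousOn hs)
      (b.continuousOn_symm.mono fun w hw => (hWs hw).2) ?_ hφq ?_
    · intro w hw
      simp only [Function.comp, hFψ, hsφ w hw]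
      rw [hb, b.right_inv (hWs hw).2]
    · simp only [Function.comp, hsq]
      rw [← hFψ, hb, b.left_inv hqs]
  refine ⟨s (F y), (heq hyW).trans ?_⟩
  conv_lhs => rw [hb]
  exact b.left_inv hyb

/-- Near z, `f - f z = h ^ n` with h injective, and `p - f z` has at most n n-th roots. -/
theorem exists_nhds_card_le_localDegree {f : ℂ → ℂ} {z : ℂ} (hf : AnalyticAt ℂ f z)
    (hne : analyticOrderAt (fun x => f x - f z) z ≠ ⊤) :
    ∃ N ∈ 𝓝 z, ∀ (p : ℂ) (T : Finset ℂ), ↑T ⊆ N → (∀ x ∈ T, f x = p) →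
      T.card ≤ localDegree f z := by
  set n := localDegree f z with hn
  have han : AnalyticAt ℂ (fun x => f x - f z) z := hf.sub analyticAt_const
  have hord : analyticOrderAt (fun x => f x - f z) z = n :=
    (Nat.cast_analyticOrderNatAt hne).symm
  have hn0 : 0 < n := by
    rw [Nat.pos_iff_ne_zero]
    intro h0
    rw [h0, Nat.cast_zero, han.analyticOrderAt_eq_zero] at hord
    simp at hord
  obtain ⟨g, hg, hgz, hfg⟩ := han.analyticOrderAt_eq_natCast.1 hord
  obtain ⟨c, hc⟩ := IsAlgClosed.exists_pow_nat_eq (g z) hn0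
  have hc0 : c ≠ 0 := by
    rintro rfl
    rw [zero_pow hn0.ne'] at hc
    exact hgz hc.symm
  -- A branch of the n-th root of g: `g x / g z` is near 1, where the logarithm is analytic, and `c
  -- ^ n = g z`.
  let r : ℂ → ℂ := fun x => c * Complex.exp (Complex.log (g x / g z) / n)
  have hr : AnalyticAt ℂ r z := by
    refine analyticAt_const.mul (((hg.div_const).clog ?_).div_const).cexp
    simp [div_self hgz]
  have hrz : r z = c := by simp [r, div_self hgz]
  have hrn : ∀ᶠ x in 𝓝 z, r x ^ n = g x := by
    filter_upwards [hg.continuousAt.eventually_ne hgz] with x hx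
    have hn' : (n : ℂ) ≠ 0 := by exact_mod_cast hn0.ne'
    simp only [r]
    rw [mul_pow, hc, ← Complex.exp_nat_mul, mul_div_cancel₀ _ hn',
      Complex.exp_log (div_ne_zero hx hgz), mul_div_cancel₀ _ hgz]
  let h : ℂ → ℂ := fun x => (x - z) * r x
  have hh : AnalyticAt ℂ h z := (analyticAt_id.sub analyticAt_const).mul hr
  have hd : HasDerivAt h c z := by
    have := ((hasDerivAt_id z).sub_const z).mul hr.differentiableAt.hasDerivAt
    simp only [id, sub_self, zero_mul, add_zero, one_mul, hrz] at this
    exact this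
  have hs : HasStrictDerivAt h c z := hd.deriv ▸ hh.hasStrictDerivAt
  let e := (hs.hasStrictFDerivAt_equiv hc0).toOpenPartialHomeomorph h
  have hze : e.source ∈ 𝓝 z := e.open_source.mem_nhds
    ((hs.hasStrictFDerivAt_equiv hc0).mem_toOpenPartialHomeomorph_source)
  have hinj : InjOn h e.source := e.injOn
  refine ⟨_, inter_mem hze (inter_mem hrn hfg), fun p T hT hp => ?_⟩
  classical
  have hTi : InjOn h T := hinj.mono fun x hx => (hT hx).1
  rw [← Finset.card_image_of_injOn hTi]
  refine (Finset.card_le_card ?_).trans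
    ((Multiset.toFinset_card_le _).trans (Polynomial.card_nthRoots n (p - f z)))
  intro w hw
  obtain ⟨x, hx, rfl⟩ := Finset.mem_image.1 hw
  obtain ⟨-, h1, h2⟩ := hT hx
  rw [Multiset.mem_toFinset, Polynomial.mem_nthRoots hn0]
  simp only [mem_ofPred_eq, smul_eq_mul] at h1 h2
  simp only [h]
  rw [mul_pow, h1, ← h2, hp x hx]

theorem HolomorphicOnDisk.continuous {F : 𝔻 → ℂ} (h : HolomorphicOnDisk F) : Continuous F := by
  obtain ⟨G, hG, hGF⟩ := h
  have : F = G ∘ ((↑) : 𝔻 → ℂ) := funext fun z => (hGF z).symm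
  rw [this]
  exact hG.continuousOn.comp_continuous Complex.UnitDisc.continuous_coe
    fun z => mem_ball_zero_iff.2 z.norm_lt_one

theorem IsConformalDisk.isOpen {V : Set ℂ} (h : IsConformalDisk V) : IsOpen V := by
  obtain ⟨F, ⟨G, hG, hGF⟩, hinj, rfl⟩ := h
  have him : range F = G '' ball 0 1 := by
    ext w
    constructor
    · rintro ⟨z, rfl⟩
      exact ⟨z, mem_ball_zero_iff.2 z.norm_lt_one, hGF z⟩
    · rintro ⟨z, hz, rfl⟩
      exact ⟨.mk z (mem_ball_zero_iff.1 hz), (hGF _).symm⟩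
  rw [him]
  rcases (hG.analyticOnNhd isOpen_ball).is_constant_or_isOpen
    (convex_ball (0 : ℂ) 1).isPreconnected with ⟨w, hw⟩ | ho
  · exfalso
    have h0 := hw 0 (by simp)
    have h1 := hw (1 / 2) (by rw [mem_ball_zero_iff]; norm_num)
    have := @hinj (.mk 0 (by simp)) (.mk (1 / 2) (by norm_num)) (by
      rw [← hGF, ← hGF]
      exact h0.trans h1.symm)
    have := congrArg ((↑) : 𝔻 → ℂ) this
    norm_num [Complex.UnitDisc.coe_mk] at this
  · exact ho _ subset_rfl isOpen_ball

/-- Disjoint neighbourhoods of the parts of a separation would already cover, and so separate, some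
`s n`. -/
theorem isConnected_iInter_of_antitone_isCompact {X : Type*} [TopologicalSpace X] [T2Space X]
    {s : ℕ → Set X} (hs : Antitone s) (hc : ∀ n, IsCompact (s n)) (hn : ∀ n, IsConnected (s n)) :
    IsConnected (⋂ n, s n) := by
  have hne : (⋂ n, s n).Nonempty :=
    IsCompact.nonempty_iInter_of_sequence_nonempty_isCompact_isClosed s
      (fun n => hs n.le_succ) (fun n => (hn n).nonempty) (hc 0) fun n => (hc n).isClosed
  have hK : IsCompact (⋂ n, s n) :=
    (hc 0).of_isClosed_subset (isClosed_iInter fun n => (hc n).isClosed) (iInter_subset _ 0)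
  refine ⟨hne, ?_⟩
  rw [isPreconnected_closed_iff]
  intro t t' ht ht' hsub ⟨p, hp, hpt⟩ ⟨q, hq, hqt⟩
  by_contra hcon
  have hdis : Disjoint ((⋂ n, s n) ∩ t) ((⋂ n, s n) ∩ t') := by
    rw [Set.disjoint_left]
    rintro x ⟨hx, hxt⟩ ⟨_, hxt'⟩
    exact hcon ⟨x, hx, hxt, hxt'⟩
  obtain ⟨O, O', oO, oO', hO, hO', hOO⟩ :=
    SeparatedNhds.of_isCompact_isCompact (hK.inter_right ht) (hK.inter_right ht') hdis
  obtain ⟨n, hsn⟩ := exists_subset_nhds_of_isCompact (directed_of_isDirected_le hs) hc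
    (U := O ∪ O') fun x hx => (oO.union oO').mem_nhds <| (hsub hx).imp
      (fun h => hO ⟨hx, h⟩) (fun h => hO' ⟨hx, h⟩)
  obtain ⟨x, -, hx, hx'⟩ := (hn n).isPreconnected O O' oO oO' hsn
    ⟨p, mem_iInter.1 hp n, hO ⟨hp, hpt⟩⟩ ⟨q, mem_iInter.1 hq n, hO' ⟨hq, hqt⟩⟩
  exact Set.disjoint_left.1 hOO hx hx'

/-! ### Iterated preimages and fibres of a generalized polynomial-like map -/

/-- The domain of the `k`-th iterate of `f : U' → U`, that is, `f⁻ᵏ(U)`. -/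
def iterateDomain (f : ℂ → ℂ) (U' U : Set ℂ) : ℕ → Set ℂ
  | 0 => U
  | k + 1 => U' ∩ f ⁻¹' iterateDomain f U' U k

instance : PreconnectedSpace 𝔻 :=
  Subtype.preconnectedSpace (convex_ball (0 : ℂ) 1).isPreconnected

theorem mem_filledJulia_iff {f : ℂ → ℂ} {U' : Set ℂ} {z : ℂ} (hz : z ∈ U') :
    z ∈ filledJulia f U' ↔ f z ∈ filledJulia f U' := by
  constructor
  · exact fun h => ⟨h.2 1, fun n => h.2 (n + 1)⟩
  · refine fun h => ⟨hz, fun n => ?_⟩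
    cases n with
    | zero => exact hz
    | succ n => exact h.2 n

theorem mapsTo_filledJulia {f : ℂ → ℂ} {U' : Set ℂ} :
    MapsTo f (filledJulia f U') (filledJulia f U') := fun _ hz => (mem_filledJulia_iff hz.1).1 hz

theorem iterate_mem_of_mem_iterateDomain {f : ℂ → ℂ} {U' U : Set ℂ} (n : ℕ) {z : ℂ}
    (hz : z ∈ iterateDomain f U' U (n + 1)) : f^[n] z ∈ U' := by
  induction n generalizing z with
  | zero => exact hz.1
  | succ n ih => exact ih hz.2

theorem mem_filledJulia_of_iterate_mem {f : ℂ → ℂ} {U' U : Set ℂ} {k : ℕ} {z : ℂ}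
    (hz : z ∈ iterateDomain f U' U k) (hK : f^[k] z ∈ filledJulia f U') :
    z ∈ filledJulia f U' := by
  induction k generalizing z with
  | zero => exact hK
  | succ k ih => exact (mem_filledJulia_iff hz.1).2 (ih hz.2 hK)

theorem iInter_iterateDomain_subset {f : ℂ → ℂ} {U' U : Set ℂ} :
    ⋂ k, iterateDomain f U' U k ⊆ filledJulia f U' := fun _ hz =>
  ⟨(mem_iInter.1 hz 1).1, fun n => iterate_mem_of_mem_iterateDomain n (mem_iInter.1 hz (n + 1))⟩

namespace IsGenPolynomialLike

variable {f : ℂ → ℂ} {U' U : Set ℂ} {N : ℕ} {D : Fin N → Set ℂ}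

theorem isOpen_range (h : IsGenPolynomialLike f U' U D) : IsOpen U := h.disk.isOpen

theorem isOpen_domain (h : IsGenPolynomialLike f U' U D) : IsOpen U' := by
  rw [h.union]
  exact isOpen_iUnion fun i => (h.disk_component i).isOpen

theorem mapsTo (h : IsGenPolynomialLike f U' U D) : MapsTo f U' U := h.proper.1

theorem domain_subset (h : IsGenPolynomialLike f U' U D) : U' ⊆ U :=
  subset_closure.trans h.closure_subset

theorem analyticAt (h : IsGenPolynomialLike f U' U D) {z : ℂ} (hz : z ∈ U') : AnalyticAt ℂ f z :=
  h.holomorphic.analyticAt (h.isOpen_domain.mem_nhds hz)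

theorem isCompact_preimage (h : IsGenPolynomialLike f U' U D) {C : Set ℂ} (hC : IsCompact C)
    (hCU : C ⊆ U) : IsCompact (U' ∩ f ⁻¹' C) := by
  obtain ⟨hm, hp⟩ := h.proper
  have hC' : IsCompact (((↑) : U → ℂ) ⁻¹' C) := by
    rw [Subtype.isCompact_iff, image_preimage_eq_of_subset (by simpa using hCU)]
    exact hC
  have := (hp.isCompact_preimage hC').image continuous_subtype_val
  convert this using 1
  ext z
  constructor
  · rintro ⟨hz, hzC⟩
    exact ⟨⟨z, hz⟩, hzC, rfl⟩
  · rintro ⟨⟨w, hw⟩, hwC, rfl⟩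
    exact ⟨hw, hwC⟩

theorem iterateDomain_succ_subset (h : IsGenPolynomialLike f U' U D) (k : ℕ) :
    iterateDomain f U' U (k + 1) ⊆ iterateDomain f U' U k := by
  induction k with
  | zero => exact inter_subset_left.trans h.domain_subset
  | succ k ih => exact fun z hz => ⟨hz.1, ih hz.2⟩

theorem antitone_iterateDomain (h : IsGenPolynomialLike f U' U D) :
    Antitone (iterateDomain f U' U) :=
  antitone_nat_of_succ_le h.iterateDomain_succ_subset

theorem isOpen_iterateDomain (h : IsGenPolynomialLike f U' U D) (k : ℕ) :
    IsOpen (iterateDomain f U' U k) := by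
  induction k with
  | zero => exact h.isOpen_range
  | succ k ih => exact h.holomorphic.continuousOn.isOpen_inter_preimage h.isOpen_domain ih

theorem mapsTo_iterate (k : ℕ) :
    MapsTo f^[k] (iterateDomain f U' U k) U := by
  induction k with
  | zero => exact fun z hz => hz
  | succ k ih => exact fun z hz => ih hz.2

theorem filledJulia_subset_iterateDomain (h : IsGenPolynomialLike f U' U D) (k : ℕ) :
    filledJulia f U' ⊆ iterateDomain f U' U k := by
  induction k with
  | zero => exact fun z hz => h.domain_subset hz.1
  | succ k ih => exact fun z hz => ⟨hz.1, ih ((mem_filledJulia_iff hz.1).1 hz)⟩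

theorem closure_iterateDomain (h : IsGenPolynomialLike f U' U D) (k : ℕ) :
    IsCompact (closure (iterateDomain f U' U (k + 1))) ∧
      closure (iterateDomain f U' U (k + 1)) ⊆ iterateDomain f U' U k := by
  refine ⟨h.compact.of_isClosed_subset isClosed_closure (closure_mono inter_subset_left), ?_⟩
  induction k with
  | zero => exact (closure_mono inter_subset_left).trans h.closure_subset
  | succ k ih =>
    have hc : IsCompact (closure (iterateDomain f U' U (k + 1))) :=
      h.compact.of_isClosed_subset isClosed_closure (closure_mono inter_subset_left)
    -- Properness makes this preimage compact, hence closed in ℂ, so the closure cannot reach the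
    -- boundary of U'.
    have h1 := h.isCompact_preimage hc
      (ih.trans (h.antitone_iterateDomain (Nat.zero_le k)))
    refine (closure_minimal ?_ h1.isClosed).trans ?_
    · exact fun z hz => ⟨hz.1, subset_closure hz.2⟩
    · exact fun z hz => ⟨hz.1, ih hz.2⟩

theorem isLocalHomeomorphOn (h : IsGenPolynomialLike f U' U D)
    (hcrit : ∀ c ∈ U', deriv f c = 0 → c ∈ filledJulia f U') :
    IsLocalHomeomorphOn f (U' \ filledJulia f U') := by
  refine IsLocalHomeomorphOn.mk _ _ fun z hz => ?_
  have hd : deriv f z ≠ 0 := fun h0 => hz.2 (hcrit z hz.1 h0)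
  have hs := (h.analyticAt hz.1).hasStrictDerivAt
  exact ⟨(hs.hasStrictFDerivAt_equiv hd).toOpenPartialHomeomorph f,
    (hs.hasStrictFDerivAt_equiv hd).mem_toOpenPartialHomeomorph_source, fun _ _ => rfl⟩

theorem isLocalHomeomorphOn_iterate (h : IsGenPolynomialLike f U' U D)
    (hcrit : ∀ c ∈ U', deriv f c = 0 → c ∈ filledJulia f U') (k : ℕ) :
    IsLocalHomeomorphOn f^[k] (iterateDomain f U' U k \ filledJulia f U') := by
  induction k with
  | zero => exact (Homeomorph.refl ℂ).isLocalHomeomorph.isLocalHomeomorphOn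
  | succ k ih =>
    exact ih.comp ((h.isLocalHomeomorphOn hcrit).mono fun z hz => ⟨hz.1.1, hz.2⟩)
      fun z hz => ⟨hz.1.2, fun hK => hz.2 ((mem_filledJulia_iff hz.1.1).2 hK)⟩

/-- A lift of a covering of `U ∖ K_f` through `fᵏ` covers the components that it meets. -/
theorem subset_range_of_isPreconnected (h : IsGenPolynomialLike f U' U D)
    (hcrit : ∀ c ∈ U', deriv f c = 0 → c ∈ filledJulia f U')
    (hK : IsClosed (filledJulia f U')) {φ : 𝔻 → ℂ}
    (hφ : IsUniversalCovering φ (U \ filledJulia f U')) {k : ℕ} {ψ : 𝔻 → ℂ} (hψ : Continuous ψ)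
    (hmem : ∀ z, ψ z ∈ iterateDomain f U' U k) (hlift : ∀ z, f^[k] (ψ z) = φ z) {B : Set ℂ}
    (hB : IsPreconnected B) (hBs : B ⊆ iterateDomain f U' U k \ filledJulia f U')
    (hne : (B ∩ range ψ).Nonempty) : B ⊆ range ψ := by
  set Y := iterateDomain f U' U k \ filledJulia f U' with hY
  have oY : IsOpen Y := (h.isOpen_iterateDomain k).sdiff hK
  have oZ : IsOpen (U \ filledJulia f U') := h.isOpen_range.sdiff hK
  have : LocallyConnectedSpace ↥(U \ filledJulia f U') := oZ.locallyConnectedSpace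
  obtain ⟨hmφ, cov⟩ := hφ.covering
  have hm : MapsTo f^[k] Y (U \ filledJulia f U') := fun z hz =>
    ⟨mapsTo_iterate k hz.1, fun hz' => hz.2 (mem_filledJulia_of_iterate_mem hz.1 hz')⟩
  have hψY : ∀ z, ψ z ∈ Y := fun z =>
    ⟨hmem z, fun hz => (hmφ z).2 (hlift z ▸ mapsTo_filledJulia.iterate k hz)⟩
  have hloc : IsLocalHomeomorph (hm.restrict f^[k] Y (U \ filledJulia f U')) := by
    refine IsLocalHomeomorph.of_comp (g := ((↑) : ↥(U \ filledJulia f U') → ℂ)) ?_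
      oZ.isOpenEmbedding_subtypeVal.isLocalHomeomorph ?_
    · rw [isLocalHomeomorph_iff_isLocalHomeomorphOn_univ]
      exact (h.isLocalHomeomorphOn_iterate hcrit k).comp
        oY.isOpenEmbedding_subtypeVal.isLocalHomeomorph.isLocalHomeomorphOn fun z _ => z.2
    · exact (h.isLocalHomeomorphOn_iterate hcrit k).continuousOn.mapsToRestrict hm
  have hcl := isClopen_range_of_isCoveringMap_comp hloc cov
    (fun z => by
      obtain ⟨x, hx⟩ : (z : ℂ) ∈ range φ := by
        rw [hφ.range_eq]
        exact z.2
      exact ⟨x, Subtype.ext hx⟩)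
    (hψ.subtype_mk hψY) (funext fun z => Subtype.ext (hlift z))
  have hB' : IsPreconnected (((↑) : Y → ℂ) ⁻¹' B) :=
    (IsInducing.subtypeVal.isPreconnected_image).1 (by
      rwa [image_preimage_eq_of_subset (by simpa using hBs)])
  obtain ⟨_, hxB, x, rfl⟩ := hne
  have := hB'.subset_isClopen hcl ⟨⟨ψ x, hψY x⟩, hxB, x, rfl⟩
  intro b hb
  obtain ⟨y, hy⟩ := this (show (⟨b, hBs hb⟩ : Y) ∈ _ from hb)
  exact ⟨y, congrArg Subtype.val hy⟩

/-- Infinite order would make f constant near z; all points there would be critical, giving K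
interior. -/
theorem analyticOrderAt_ne_top (h : IsGenPolynomialLike f U' U D)
    (hcrit : ∀ c ∈ U', deriv f c = 0 → c ∈ filledJulia f U')
    (hint : interior (filledJulia f U') = ∅) {z : ℂ} (hz : z ∈ U') :
    analyticOrderAt (fun x => f x - f z) z ≠ ⊤ := by
  rw [Ne, analyticOrderAt_eq_top]
  intro h0
  have : filledJulia f U' ∈ 𝓝 z := by
    filter_upwards [h0.eventually_nhds, h.isOpen_domain.mem_nhds hz] with x hx hxU
    refine hcrit x hxU ?_
    have : f =ᶠ[𝓝 x] fun _ => f z := hx.mono fun y hy => sub_eq_zero.1 hy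
    rw [this.deriv_eq, deriv_const]
  have := mem_interior_iff_mem_nhds.2 this
  rw [hint] at this
  exact this

theorem finite_fiber (h : IsGenPolynomialLike f U' U D)
    (hcrit : ∀ c ∈ U', deriv f c = 0 → c ∈ filledJulia f U')
    (hint : interior (filledJulia f U') = ∅) {w : ℂ} (hw : w ∈ U) :
    (U' ∩ f ⁻¹' {w}).Finite := by
  by_contra hinf
  -- Fibres are compact by properness, so an infinite one accumulates at a point of itself, where f
  -- would be locally constant.
  obtain ⟨z, hz, hacc⟩ := Set.Infinite.exists_accPt_of_subset_isCompact hinf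
    (h.isCompact_preimage isCompact_singleton (singleton_subset_iff.2 hw)) subset_rfl
  have han : AnalyticAt ℂ (fun x => f x - f z) z := (h.analyticAt hz.1).sub analyticAt_const
  rcases han.eventually_eq_zero_or_eventually_ne_zero with h0 | h0
  · exact h.analyticOrderAt_ne_top hcrit hint hz.1 (analyticOrderAt_eq_top.2 h0)
  · rw [accPt_iff_frequently_nhdsNE] at hacc
    obtain ⟨x, hx, hx'⟩ := (hacc.and_eventually h0).exists
    exact hx' (by rw [show f x = w from hx.2, show f z = w from hz.2, sub_self])

theorem sum_localDegree (h : IsGenPolynomialLike f U' U D)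
    (hcrit : ∀ c ∈ U', deriv f c = 0 → c ∈ filledJulia f U')
    (hint : interior (filledJulia f U') = ∅) {d : ℕ} (hd : HasTotalDegree f U D d) {w : ℂ}
    (hw : w ∈ U) : ∑ z ∈ (h.finite_fiber hcrit hint hw).toFinset, localDegree f z = d := by
  obtain ⟨e, he, rfl⟩ := hd
  rw [← finsum_mem_eq_finite_toFinset_sum]
  have : U' ∩ f ⁻¹' {w} = ⋃ i, D i ∩ f ⁻¹' {w} := by rw [h.union, iUnion_inter]
  rw [this, finsum_mem_iUnion]
  · rw [finsum_eq_sum_of_fintype]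
    exact Finset.sum_congr rfl fun i _ => he i w hw
  · exact fun i j hij => (h.disjoint hij).mono inter_subset_left inter_subset_left
  · refine fun i => (h.finite_fiber hcrit hint hw).subset ?_
    rw [this]
    exact subset_iUnion (fun i => D i ∩ f ⁻¹' {w}) i

end IsGenPolynomialLike

/-! ### The components `φ(V_e)` -/

/-- A generalized polynomial-like map whose filled-in Julia set is a Cantor set containing the
critical points, with a good family of lifts of the inverse branches. -/
structure IsCantorSystem (f : ℂ → ℂ) (U' U : Set ℂ) {N : ℕ} (D : Fin N → Set ℂ) {d : ℕ}
    (φ : 𝔻 → ℂ) (g : Fin d → 𝔻 → 𝔻) (γ : (k : ℕ) → (Fin k → Fin d) → Fin k → (𝔻 ≃ₜ 𝔻)) :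
    Prop where
  polynomialLike : IsGenPolynomialLike f U' U D
  degree : HasTotalDegree f U D d
  isCompact : IsCompact (filledJulia f U')
  isTotallyDisconnected : IsTotallyDisconnected (filledJulia f U')
  interior_eq : interior (filledJulia f U') = ∅
  critical : ∀ c ∈ U', deriv f c = 0 → c ∈ filledJulia f U'
  covering : IsUniversalCovering φ (U \ filledJulia f U')
  lifts : AreLiftedInverses f U' φ g
  family : IsGoodFamily φ g γ

theorem IsUniversalCovering.mem {φ : 𝔻 → ℂ} {X : Set ℂ} (h : IsUniversalCovering φ X) (z : 𝔻) :
    φ z ∈ X := h.covering.1 z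

theorem AreLiftedInverses.continuous {f : ℂ → ℂ} {U' : Set ℂ} {φ : 𝔻 → ℂ} {d : ℕ}
    {g : Fin d → 𝔻 → 𝔻} (hg : AreLiftedInverses f U' φ g) (j : Fin d) : Continuous (g j) :=
  Complex.UnitDisc.isEmbedding_coe.continuous_iff.2 (hg.holomorphic j).continuous

theorem continuous_composition {f : ℂ → ℂ} {U' : Set ℂ} {φ : 𝔻 → ℂ} {d : ℕ}
    {g : Fin d → 𝔻 → 𝔻} (hg : AreLiftedInverses f U' φ g) (k : ℕ) (Γ : Fin k → (𝔻 ≃ₜ 𝔻))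
    (e : Fin k → Fin d) : Continuous (composition g k Γ e) := by
  induction k with
  | zero => exact continuous_id
  | succ k ih => exact (Γ 0).continuous.comp ((hg.continuous _).comp (ih _ _))

theorem composition_lift {f : ℂ → ℂ} {U' U : Set ℂ} {φ : 𝔻 → ℂ} {d : ℕ}
    {g : Fin d → 𝔻 → 𝔻} (hφ : ∀ z, φ z ∈ U) (hg : AreLiftedInverses f U' φ g) (k : ℕ)
    (Γ : Fin k → (𝔻 ≃ₜ 𝔻)) (hΓ : ∀ l, Γ l ∈ deckTransformations φ) (e : Fin k → Fin d) (z : 𝔻) :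
    φ (composition g k Γ e z) ∈ iterateDomain f U' U k ∧
      f^[k] (φ (composition g k Γ e z)) = φ z := by
  induction k with
  | zero => exact ⟨hφ z, rfl⟩
  | succ k ih =>
    have h1 : φ (composition g (k + 1) Γ e z) =
        φ (g (e 0) (composition g k (Fin.tail Γ) (Fin.tail e) z)) := (hΓ 0).2 _
    obtain ⟨h2, h3⟩ := ih (Fin.tail Γ) (fun l => hΓ l.succ) (Fin.tail e)
    rw [h1, Function.iterate_succ_apply, hg.lift]
    refine ⟨⟨hg.mem _ _, ?_⟩, h3⟩
    rw [mem_preimage, hg.lift]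
    exact h2

/-- The sequence `jε`. -/
def consSeq {d : ℕ} (j : Fin d) (ε : ℕ → Fin d) : ℕ → Fin d
  | 0 => j
  | n + 1 => ε n

theorem consSeq_shift {d : ℕ} (ε : ℕ → Fin d) : consSeq (ε 0) (shift ε) = ε := by
  funext n
  cases n <;> rfl

namespace IsCantorSystem

variable {f : ℂ → ℂ} {U' U : Set ℂ} {N : ℕ} {D : Fin N → Set ℂ} {d : ℕ}
    {φ : 𝔻 → ℂ} {g : Fin d → 𝔻 → 𝔻} {γ : (k : ℕ) → (Fin k → Fin d) → Fin k → (𝔻 ≃ₜ 𝔻)}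

theorem continuous_covering (h : IsCantorSystem f U' U D φ g γ) : Continuous φ :=
  h.covering.holomorphic.continuous

theorem composition_lift (h : IsCantorSystem f U' U D φ g γ) (k : ℕ) (e : Fin k → Fin d)
    (z : 𝔻) : φ (composition g k (γ k e) e z) ∈ iterateDomain f U' U k ∧
      f^[k] (φ (composition g k (γ k e) e z)) = φ z :=
  PolyLikeShift.composition_lift (fun z => (h.covering.mem z).1) h.lifts k _ (h.family.deck k e) e z

theorem image_liftedSet (k : ℕ) (e : Fin k → Fin d) :
    φ '' liftedSet g γ k e = range (φ ∘ composition g k (γ k e) e) := (range_comp _ _).symm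

theorem image_liftedSet_subset (h : IsCantorSystem f U' U D φ g γ) (k : ℕ) (e : Fin k → Fin d) :
    φ '' liftedSet g γ k e ⊆ iterateDomain f U' U k \ filledJulia f U' := by
  rw [image_liftedSet]
  rintro _ ⟨z, rfl⟩
  exact ⟨(h.composition_lift k e z).1, (h.covering.mem _).2⟩

theorem isConnected_image_liftedSet (h : IsCantorSystem f U' U D φ g γ) (k : ℕ)
    (e : Fin k → Fin d) : IsConnected (φ '' liftedSet g γ k e) := by
  rw [image_liftedSet]
  have : ConnectedSpace 𝔻 := ⟨⟨0⟩⟩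
  exact isConnected_range (h.continuous_covering.comp (continuous_composition h.lifts _ _ _))

/-- Together with connectedness, this makes `φ(V_e)` a connected component of `f⁻ᵏ(U) \ K`. -/
theorem subset_image_liftedSet (h : IsCantorSystem f U' U D φ g γ) (k : ℕ) (e : Fin k → Fin d)
    {B : Set ℂ} (hB : IsPreconnected B)
    (hBs : B ⊆ iterateDomain f U' U k \ filledJulia f U')
    (hne : (B ∩ φ '' liftedSet g γ k e).Nonempty) : B ⊆ φ '' liftedSet g γ k e := by
  rw [image_liftedSet] at hne ⊢
  exact h.polynomialLike.subset_range_of_isPreconnected h.critical h.isCompact.isClosed h.covering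
    (h.continuous_covering.comp (continuous_composition h.lifts _ _ _))
    (fun z => (h.composition_lift k e z).1) (fun z => (h.composition_lift k e z).2) hB hBs hne

/-- Shift invariance fixes all deck transformations but the outermost, which φ absorbs. The right
side involves the set V of the tail itself, not just its image under φ; this is why merging is
needed later. -/
theorem image_liftedSet_succ (h : IsCantorSystem f U' U D φ g γ) (k : ℕ)
    (e : Fin (k + 1) → Fin d) :
    φ '' liftedSet g γ (k + 1) e = (fun q => φ (g (e 0) q)) '' liftedSet g γ k (Fin.tail e) := by
  have h1 : Fin.tail (γ (k + 1) e) = γ k (Fin.tail e) :=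
    funext fun l => h.family.shift_invariant k e l
  rw [image_liftedSet, liftedSet, ← range_comp]
  congr 1
  funext z
  simp only [Function.comp, composition, h1]
  exact (h.family.deck _ _ _).2 _

theorem image_image_liftedSet (h : IsCantorSystem f U' U D φ g γ) (k : ℕ)
    (e : Fin (k + 1) → Fin d) :
    f '' (φ '' liftedSet g γ (k + 1) e) = φ '' liftedSet g γ k (Fin.tail e) := by
  rw [h.image_liftedSet_succ, image_image]
  exact image_congr fun q _ => h.lifts.lift _ q

/-! ### The limit point of a sequence and its dependence on the sequence -/

theorem antitone_closure (h : IsCantorSystem f U' U D φ g γ) (ε : ℕ → Fin d) :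
    Antitone fun k : ℕ => closure (φ '' liftedSet g γ k fun i => ε i) :=
  antitone_nat_of_succ_le fun k => closure_mono (image_mono (h.family.nested k fun i => ε i))

theorem antitone_closure_succ (h : IsCantorSystem f U' U D φ g γ) (ε : ℕ → Fin d) :
    Antitone fun k : ℕ => closure (φ '' liftedSet g γ (k + 1) fun i => ε i) :=
  fun _ _ hkl => h.antitone_closure ε (Nat.add_le_add_right hkl 1)

theorem isCompact_closure (h : IsCantorSystem f U' U D φ g γ) (ε : ℕ → Fin d) (k : ℕ) :
    IsCompact (closure (φ '' liftedSet g γ (k + 1) fun i => ε i)) :=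
  (h.polynomialLike.closure_iterateDomain k).1.of_isClosed_subset isClosed_closure
    (closure_mono ((h.image_liftedSet_subset _ _).trans sdiff_subset))

theorem exists_limitSet_eq (h : IsCantorSystem f U' U D φ g γ) (ε : ℕ → Fin d) :
    ∃ p ∈ filledJulia f U', limitSet φ g γ ε = {p} := by
  have hc : IsConnected (limitSet φ g γ ε) :=
    isConnected_iInter_of_antitone_isCompact (h.antitone_closure_succ ε) (h.isCompact_closure ε)
      fun k => (h.isConnected_image_liftedSet _ _).closure
  have hK : limitSet φ g γ ε ⊆ filledJulia f U' := by
    refine subset_trans (iInter_mono fun k => ?_) (iInter_iterateDomain_subset (U := U))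
    exact (closure_mono ((h.image_liftedSet_subset _ _).trans sdiff_subset)).trans
      (h.polynomialLike.closure_iterateDomain k).2
  obtain ⟨p, hp⟩ := hc.nonempty
  exact ⟨p, hK hp,
    (h.isTotallyDisconnected _ hK hc.isPreconnected).eq_singleton_of_mem hp⟩

theorem exists_image_subset_of_mem_nhds (h : IsCantorSystem f U' U D φ g γ) {ε : ℕ → Fin d}
    {p : ℂ} (hp : limitSet φ g γ ε = {p}) {O : Set ℂ} (hO : O ∈ 𝓝 p) :
    ∀ᶠ k : ℕ in atTop, φ '' liftedSet g γ (k + 1) (fun i => ε i) ⊆ O := by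
  obtain ⟨n, hn⟩ := exists_subset_nhds_of_isCompact
    (directed_of_isDirected_le (h.antitone_closure_succ ε)) (h.isCompact_closure ε) (U := O)
    fun x hx => by
      have : x ∈ limitSet φ g γ ε := hx
      rw [hp, mem_singleton_iff] at this
      rwa [this]
  filter_upwards [eventually_ge_atTop n] with k hk
  exact subset_closure.trans ((h.antitone_closure_succ ε hk).trans hn)

theorem mem_closure_of_limitSet_eq (h : IsCantorSystem f U' U D φ g γ) {ε : ℕ → Fin d}
    {p : ℂ} (hp : limitSet φ g γ ε = {p}) (k : ℕ) :
    p ∈ closure (φ '' liftedSet g γ k fun i => ε i) := by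
  have : p ∈ limitSet φ g γ ε := hp ▸ mem_singleton p
  exact h.antitone_closure ε k.le_succ (mem_iInter.1 this k)

theorem map_limit (h : IsCantorSystem f U' U D φ g γ) {ε : ℕ → Fin d} {p q : ℂ}
    (hpK : p ∈ filledJulia f U') (hp : limitSet φ g γ ε = {p})
    (hq : limitSet φ g γ (shift ε) = {q}) : f p = q := by
  rw [← mem_singleton_iff, ← hq]
  refine mem_iInter.2 fun k => ?_
  -- f deletes the first symbol: a (k+2)-block of ε becomes a (k+1)-block of its shift.
  have h1 := (h.polynomialLike.analyticAt hpK.1).continuousAt.continuousWithinAt.mem_closure_image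
    (h.mem_closure_of_limitSet_eq hp (k + 2))
  rwa [h.image_image_liftedSet] at h1

/-- A small disk about p minus K is connected and meets both components, so they coincide. -/
theorem image_liftedSet_eq_of_limitSet_eq (h : IsCantorSystem f U' U D φ g γ) {ε ε' : ℕ → Fin d}
    {p : ℂ} (hpK : p ∈ filledJulia f U') (hp : limitSet φ g γ ε = {p})
    (hp' : limitSet φ g γ ε' = {p}) (k : ℕ) :
    φ '' liftedSet g γ k (fun i => ε i) = φ '' liftedSet g γ k (fun i => ε' i) := by
  obtain ⟨r, hr, hball⟩ := Metric.isOpen_iff.1 (h.polynomialLike.isOpen_iterateDomain k) p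
    (h.polynomialLike.filledJulia_subset_iterateDomain k hpK)
  have hB := isPreconnected_ball_diff_of_isTotallyDisconnected h.isCompact.isClosed
    h.isTotallyDisconnected p hr
  have hBs : ball p r \ filledJulia f U' ⊆ iterateDomain f U' U k \ filledJulia f U' :=
    fun z hz => ⟨hball hz.1, hz.2⟩
  have key : ∀ e : ℕ → Fin d, limitSet φ g γ e = {p} →
      (ball p r \ filledJulia f U').Nonempty ∧
        ball p r \ filledJulia f U' ⊆ φ '' liftedSet g γ k (fun i => e i) := by
    intro e he
    obtain ⟨x, hxb, hx⟩ := mem_closure_iff.1 (h.mem_closure_of_limitSet_eq he k) _ isOpen_ball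
      (mem_ball_self hr)
    have hxB : x ∈ ball p r \ filledJulia f U' := ⟨hxb, (h.image_liftedSet_subset _ _ hx).2⟩
    exact ⟨⟨x, hxB⟩, h.subset_image_liftedSet k _ hB hBs ⟨x, hxB, hx⟩⟩
  obtain ⟨⟨x, hx⟩, h1⟩ := key ε hp
  have h2 := (key ε' hp').2
  exact ((h.subset_image_liftedSet k _ (h.isConnected_image_liftedSet _ _).isPreconnected
      (h.image_liftedSet_subset _ _) ⟨x, h1 hx, h2 hx⟩)).antisymm
    ((h.subset_image_liftedSet k _ (h.isConnected_image_liftedSet _ _).isPreconnected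
      (h.image_liftedSet_subset _ _) ⟨x, h2 hx, h1 hx⟩))

theorem limitSet_consSeq_eq (h : IsCantorSystem f U' U D φ g γ) {ε ε' : ℕ → Fin d}
    {p : ℂ} (hpK : p ∈ filledJulia f U') (hp : limitSet φ g γ ε = {p})
    (hp' : limitSet φ g γ ε' = {p}) (j : Fin d) :
    limitSet φ g γ (consSeq j ε) = limitSet φ g γ (consSeq j ε') := by
  refine iInter_congr fun k => ?_
  have h1 := h.family.merged k _ _ (h.image_liftedSet_eq_of_limitSet_eq hpK hp hp' k)
  rw [h.image_liftedSet_succ, h.image_liftedSet_succ]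
  exact congrArg closure (congrArg (image fun q => φ (g j q)) h1)

/-! ### Counting symbols -/

/-- Two lifts of φ through the local homeomorphism f on `U' \ K` that agree at q agree everywhere,
in particular at 0. -/
theorem injective_lifts (h : IsCantorSystem f U' U D φ g γ) (q : 𝔻) :
    Function.Injective fun j => φ (g j q) := by
  intro i j hij
  set Y := U' \ filledJulia f U' with hY
  have oY : IsOpen Y := h.polynomialLike.isOpen_domain.sdiff h.isCompact.isClosed
  have hloc : IsLocalHomeomorph (f ∘ ((↑) : Y → ℂ)) := by
    rw [isLocalHomeomorph_iff_isLocalHomeomorphOn_univ]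
    exact (h.polynomialLike.isLocalHomeomorphOn h.critical).comp
      oY.isOpenEmbedding_subtypeVal.isLocalHomeomorph.isLocalHomeomorphOn fun z _ => z.2
  have hm : ∀ j z, φ (g j z) ∈ Y := fun j z => ⟨h.lifts.mem j z, (h.covering.mem _).2⟩
  have hcont : ∀ j, Continuous fun z => (⟨φ (g j z), hm j z⟩ : Y) := fun j =>
    (h.continuous_covering.comp (h.lifts.continuous j)).subtype_mk _
  have := (T2Space.isSeparatedMap (f ∘ ((↑) : Y → ℂ))).eq_of_comp_eq hloc.isLocallyInjective
    (hcont i) (hcont j)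
    (funext fun z => (h.lifts.lift i z).trans (h.lifts.lift j z).symm) q (Subtype.ext hij)
  exact h.lifts.injective (congrArg Subtype.val (congr_fun this 0))

theorem card_le_localDegree (h : IsCantorSystem f U' U D φ g γ) {ε : ℕ → Fin d} {z : ℂ}
    (hz : z ∈ U') {S : Finset (Fin d)} (hS : ∀ j ∈ S, limitSet φ g γ (consSeq j ε) = {z}) :
    S.card ≤ localDegree f z := by
  obtain ⟨O, hO, hcard⟩ := exists_nhds_card_le_localDegree (h.polynomialLike.analyticAt hz)
    (h.polynomialLike.analyticOrderAt_ne_top h.critical h.interior_eq hz)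
  have hev : ∀ᶠ k : ℕ in atTop, ∀ j ∈ S,
      φ '' liftedSet g γ (k + 1) (fun i => consSeq j ε i) ⊆ O :=
    (Finset.eventually_all S).2 fun j hj => h.exists_image_subset_of_mem_nhds (hS j hj) hO
  obtain ⟨k, hk⟩ := hev.exists
  set q : 𝔻 := composition g k (γ k fun i => ε i) (fun i => ε i) 0
  have hq : q ∈ liftedSet g γ k fun i => ε i := mem_range_self _
  classical
  rw [← Finset.card_image_of_injective S (h.injective_lifts q)]
  refine hcard (φ q) _ ?_ ?_
  · intro x hx
    obtain ⟨j, hj, rfl⟩ := Finset.mem_image.1 (Finset.mem_coe.1 hx)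
    refine hk j hj ?_
    rw [h.image_liftedSet_succ]
    exact ⟨q, hq, rfl⟩
  · intro x hx
    obtain ⟨j, hj, rfl⟩ := Finset.mem_image.1 hx
    exact h.lifts.lift j q

theorem localDegree_le (h : IsCantorSystem f U' U D φ g γ) {z : ℂ} (hz : z ∈ U') :
    localDegree f z ≤ d := by
  have hw := h.polynomialLike.mapsTo hz
  conv_rhs => rw [← h.polynomialLike.sum_localDegree h.critical h.interior_eq h.degree hw]
  exact Finset.single_le_sum (f := localDegree f) (fun _ _ => Nat.zero_le _)
    ((Finite.mem_toFinset _).2 ⟨hz, rfl⟩)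

/-- Over the fibre of `f z`, symbol counts and local degrees both sum to d, and the former are
termwise at most the latter. -/
theorem card_eq_localDegree (h : IsCantorSystem f U' U D φ g γ) {π : (ℕ → Fin d) → ℂ}
    (hπ : ∀ ε, limitSet φ g γ ε = {π ε}) (hπK : ∀ ε, π ε ∈ filledJulia f U') {ε : ℕ → Fin d}
    {z : ℂ} (hz : z ∈ U') (hε : π ε = f z) :
    (Finset.univ.filter fun j => π (consSeq j ε) = z).card = localDegree f z := by
  have hw : f z ∈ U := h.polynomialLike.mapsTo hz
  set F := (h.polynomialLike.finite_fiber h.critical h.interior_eq hw).toFinset with hF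
  have hmem : ∀ x, x ∈ F ↔ x ∈ U' ∧ f x = f z := fun x => Finite.mem_toFinset _
  have hsum := h.polynomialLike.sum_localDegree h.critical h.interior_eq h.degree hw
  have hcard : ∑ x ∈ F, (Finset.univ.filter fun j => π (consSeq j ε) = x).card = d := by
    rw [← Finset.card_eq_sum_card_fiberwise, Finset.card_univ, Fintype.card_fin]
    intro j _
    refine (hmem _).2 ⟨(hπK _).1, ?_⟩
    rw [← hε]
    exact h.map_limit (hπK _) (hπ _) (hπ ε)
  refine (Finset.sum_eq_sum_iff_of_le fun x hx => ?_).1 (hcard.trans hsum.symm) z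
    ((hmem z).2 ⟨hz, rfl⟩)
  refine h.card_le_localDegree (ε := ε) ((hmem x).1 hx).1 fun j hj => ?_
  rw [hπ, (Finset.mem_filter.1 hj).2]

theorem exists_symbols (h : IsCantorSystem f U' U D φ g γ) {π : (ℕ → Fin d) → ℂ}
    (hπ : ∀ ε, limitSet φ g γ ε = {π ε}) (hπK : ∀ ε, π ε ∈ filledJulia f U') {z : ℂ}
    (hz : z ∈ filledJulia f U') : ∃ S : Finset (Fin d), S.card = localDegree f z ∧
      ∀ ε, π ε = z ↔ (π (shift ε) = f z ∧ ε 0 ∈ S) := by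
  have hshift : ∀ ε, π ε = z → π (shift ε) = f z := by
    rintro ε rfl
    exact (h.map_limit (hπK _) (hπ _) (hπ _)).symm
  by_cases hex : ∃ ε, π ε = f z
  · obtain ⟨ε₀, hε₀⟩ := hex
    refine ⟨_, h.card_eq_localDegree hπ hπK hz.1 hε₀, fun ε => ?_⟩
    have key : π (shift ε) = f z → π (consSeq (ε 0) ε₀) = π ε := by
      intro hε
      have := h.limitSet_consSeq_eq (hπK ε₀) (hπ ε₀) (by rw [hπ, hε, hε₀]) (ε 0) (ε' := shift ε)
      rwa [consSeq_shift, hπ, hπ, singleton_eq_singleton_iff] at this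
    rw [Finset.mem_filter]
    constructor
    · exact fun hε => ⟨hshift ε hε, Finset.mem_univ _, (key (hshift ε hε)).trans hε⟩
    · exact fun ⟨hε, _, h2⟩ => (key hε).symm.trans h2
  -- If π misses `f z`, it misses z as well; both sides of the equivalence are false and any set of
  -- the right size works.
  · obtain ⟨S, -, hS⟩ := Finset.exists_subset_card_eq (s := (Finset.univ : Finset (Fin d)))
      (n := localDegree f z) (by simpa using h.localDegree_le hz.1)
    exact ⟨S, hS, fun ε => ⟨fun hε => (hex ⟨_, hshift ε hε⟩).elim, fun hε => (hex ⟨_, hε.1⟩).elim⟩⟩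

end IsCantorSystem

/-! ### From symbols to cardinalities, and the theorem -/

theorem encard_eq_mul_of_symbols {d : ℕ} {A B : Set (ℕ → Fin d)} {S : Finset (Fin d)}
    (hS : ∀ ε, ε ∈ A ↔ shift ε ∈ B ∧ ε 0 ∈ S) : A.encard = S.card * B.encard := by
  have : A = (fun p : Fin d × (ℕ → Fin d) => consSeq p.1 p.2) '' ((S : Set (Fin d)) ×ˢ B) := by
    ext ε
    constructor
    · intro hε
      obtain ⟨h1, h2⟩ := (hS ε).1 hε
      exact ⟨(ε 0, shift ε), ⟨h2, h1⟩, consSeq_shift ε⟩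
    · rintro ⟨⟨j, ε⟩, ⟨hj, hε⟩, rfl⟩
      exact (hS _).2 ⟨hε, hj⟩
  rw [this, Function.Injective.encard_image, encard_prod, encard_coe_eq_coe_finsetCard]
  rintro ⟨i, ε⟩ ⟨j, ε'⟩ h
  exact Prod.ext (congr_fun h 0) (congrArg shift h)

end PolyLikeShift

open PolyLikeShift Complex.UnitDisc in
theorem mainTheorem2 (f : ℂ → ℂ) (U' U : Set ℂ) (N : ℕ) (D : Fin N → Set ℂ)
    (hf : IsGenPolynomialLike f U' U D) (d : ℕ) (hd : HasTotalDegree f U D d) (hd1 : 1 < d)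
    (hKJ : filledJulia f U' = julia f U') (hCantor : IsCantorSet (julia f U'))
    (hcrit : ∀ c ∈ U', deriv f c = 0 → c ∈ filledJulia f U')
    (φ : 𝔻 → ℂ) (hφ : IsUniversalCovering φ (U \ julia f U'))
    (g : Fin d → 𝔻 → 𝔻) (hg : AreLiftedInverses f U' φ g)
    (γ : (k : ℕ) → (Fin k → Fin d) → Fin k → (𝔻 ≃ₜ 𝔻)) (hγ : IsGoodFamily φ g γ) :
    ∃ π : (ℕ → Fin d) → julia f U',
      (∀ ε, limitSet φ g γ ε = {(π ε : ℂ)}) ∧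
      ∀ z ∈ julia f U',
        {ε | (π ε : ℂ) = z}.encard = localDegree f z * {ε | (π ε : ℂ) = f z}.encard ∧
        ∃ S : Finset (Fin d), S.card = localDegree f z ∧
          ∀ ε, (π ε : ℂ) = z ↔ ((π (shift ε) : ℂ) = f z ∧ ε 0 ∈ S) := by
  obtain ⟨c⟩ := hCantor
  have hcomp : IsCompact (julia f U') := by
    have := c.symm.compactSpace
    exact isCompact_iff_compactSpace.2 this
  have htd : IsTotallyDisconnected (julia f U') := by
    have : TotallyDisconnectedSpace (julia f U') := c.symm.totallyDisconnectedSpace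
    exact totallyDisconnectedSpace_subtype_iff.1 this
  have hint : interior (filledJulia f U') = ∅ := by
    rw [Set.eq_empty_iff_forall_notMem]
    intro x hx
    have : x ∈ julia f U' := hKJ.subset (interior_subset hx)
    exact this.2 hx
  have h : IsCantorSystem f U' U D φ g γ :=
    ⟨hf, hd, hKJ ▸ hcomp, hKJ ▸ htd, hint, hcrit, hKJ ▸ hφ, hg, hγ⟩
  choose p hpK hp using h.exists_limitSet_eq
  refine ⟨fun ε => ⟨p ε, hKJ ▸ hpK ε⟩, hp, fun z hz => ?_⟩
  obtain ⟨S, hS, hSε⟩ := h.exists_symbols hp hpK (z := z) (hKJ ▸ hz)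
  exact ⟨hS ▸ encard_eq_mul_of_symbols hSε, S, hS, hSε⟩
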